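/- **Setting.** Let $d\in\{2,3\}$ and let $\Omega\subset\mathbb R^d$ be a polygonal/polyhedral domain (open, connected, equal to the interior of its closure). Let $\mathcal T_1,\dots,\mathcal T_K$ be partitions of $\Omega$ (up to null sets) into finitely many disjoint open elements $T=F_T(\widehat T)$, where $\widehat T$ is either the unit simplex or the unit hypercube, the same for all elements, and each $F_T$ is an invertible affine map. The partitions are nested: for $k\le l$ every element of $\mathcal T_l$ lies in an element of $\mathcal T_k$ (and, for hypercubes, has edges parallel to those of that element), as is the case for successive uniform refinements. Let $h_T=\operatorname{diam}T$, $h_k=\max_{T\in\mathcal T_k}h_T$, let $1\le p_1\le\dots\le p_K$ be integers, and let $$V_k=\{v\in L^2(\Omega): v\circ F_T\in\mathbb M^{p_k}(\widehat T)\ \ \forall T\in\mathcal T_k\},$$ where $\mathbb M^{p}(\widehat T)$ consists of the polynomials of total degree at most $p$ (simplex) or of degree at most $p$ in each variable (hypercube). Then $V_1\subseteq\dots\subseteq V_K$; let $R_k^K:V_k\to V_K$ be the natural injection. Given a basis of $\mathbb M^{p_k}(\widehat T)$ that is orthonormal in $L^2(\widehat T)$, transported to each element by $F_T$, let $v_1,\dots,v_{n_k}$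 be the coefficients of $v\in V_k$ in the resulting basis of $V_k$, and put $(u,v)_k=h_k^d\sum_i u_iv_i$. **The method on the finest level.** An interior face $F$ of $\mathcal T_K$ is the intersection of the closures of two neighbouring elements $T^\pm$, with outward unit normals $n^\pm$; a boundary face is the part on $\partial\Omega$ of a facet of an element $T$, with outward unit normal $n$. On interior faces put $[\![v]\!]=v^+n^++v^-n^-$, $\{\eta\}=\tfrac12(\eta^++\eta^-)$, $[\![\eta]\!]=\eta^+\cdot n^++\eta^-\cdot n^-$; on boundary faces put $[\![v]\!]=vn$, $\{\eta\}=\eta$. Let $\beta$ be a vector on each interior face. The liftings $r_F([\![v]\!]),\,l_F(\beta\cdot[\![v]\!])\in[V_K]^d$ are defined by $$\int_\Omega r_F([\![v]\!])\cdot\eta\,dx=-\int_F[\![v]\!]\cdot\{\eta\}\,ds,\qquad \int_\Omega l_F(\beta\cdot[\![v]\!])\cdot\eta\,dx=-\int_F(\beta\cdot[\![v]\!])\,[\![\eta]\!]\,ds\qquad\forall\eta\in[V_K]^d,$$ for all faces in the case of $r_F$ and for interior faces in the case of $l_F$, and $\ell(v)=\sum_F r_F([\![v]\!])+\sum_{F\text{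 interior}}l_F(\beta\cdot[\![v]\!])$. For $\alpha>0$ let $$\mathcal A_K(w,v)=\sum_{T\in\mathcal T_K}\int_T\big(\nabla w\cdot\nabla v+\nabla w\cdot\ell(v)+\ell(w)\cdot\nabla v\big)dx+\sum_F\int_F\sigma\,[\![w]\!]\cdot[\![v]\!]\,ds+\theta\int_\Omega\ell(w)\cdot\ell(v)\,dx,$$ where $\sigma=\alpha p_K^2/\min(h_{T^+},h_{T^-})$ on interior faces and $\sigma=\alpha p_K^2/h_T$ on boundary faces. The method is one of: SIPG ($\theta=0$, $\beta=0$); SIPG($\delta$) ($\theta=0$, $\beta=(\delta-\tfrac12)n^+$ with $\delta\in[0,1]$ on each interior face); LDG ($\theta=1$, $\beta$ arbitrary). For SIPG and SIPG($\delta$) the stabilization parameter $\alpha$ is assumed to be so large that $\mathcal A_K(w,w)\ge0$ for all $w\in V_K$ (for LDG nothing is assumed). **Inherited forms and smoother.** For $k=1,\dots,K$ let $\mathcal A_k^{\rm R}(v,w)=\mathcal A_K(R_k^Kv,R_k^Kw)$ on $V_k$, and let $A_k^{\rm R}:V_k\to V_k$ be the operator with $(A_k^{\rm R}v,w)_k=\mathcal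 A_k^{\rm R}(v,w)$ for all $v,w\in V_k$. For $s\ge0$ put $|||v|||_{s,k}=\sqrt{((A_k^{\rm R})^sv,v)_k}$, with the power defined by the spectral theorem. Let $\Lambda_k^{\rm R}>0$ and $G_k=I-\frac1{\Lambda_k^{\rm R}}A_k^{\rm R}$. **Lemma 6.1.** For every $C_0>0$ there is a constant $C>0$, depending only on $C_0$, such that in the above setting, for every level $k$, if $\Lambda_k^{\rm R}$ bounds the spectral radius of $A_k^{\rm R}$ and $$\Lambda_k^{\rm R}\le C_0\,\frac{p_K^2p_k^2}{h_Kh_k},$$ then for all $v\in V_k$, all integers $m\ge0$ and all real $0\le t\le s\le2$, $$|||G_k^mv|||_{s,k}\le C\,(p_Kp_k)^{s-t}(h_Kh_k)^{(t-s)/2}(1+m)^{(t-s)/2}\,|||v|||_{t,k}.$$ -/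

import Mathlib

open MeasureTheory Set

namespace HpDG

noncomputable section

/-- Euclidean space `ℝᵈ`. -/
abbrev E (d : ℕ) := EuclideanSpace ℝ (Fin d)

/-- The two kinds of reference element. -/
inductive Shape where
  | simplex
  | cube

/-- The reference element: the open unit simplex or the open unit hypercube in `ℝᵈ`. -/
def Shape.ref : Shape → (d : ℕ) → Set (E d)
  | .simplex, _ => {x | (∀ i, 0 < x i) ∧ ∑ i, x i < 1}
  | .cube, _ => {x | ∀ i, 0 < x i ∧ x i < 1}

/-- Labels of the facets of the reference element: the `d + 1` facets `{xᵢ = 0}`, `{∑ xⱼ = 1}` of the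
simplex, the `2 d` facets `{xᵢ = 0}`, `{xᵢ = 1}` of the hypercube. -/
def Shape.Facet : Shape → ℕ → Type
  | .simplex, d => Option (Fin d)
  | .cube, d => Fin d × Bool

instance (s : Shape) (d : ℕ) : Fintype (s.Facet d) := by
  cases s
  · exact inferInstanceAs (Fintype (Option (Fin d)))
  · exact inferInstanceAs (Fintype (Fin d × Bool))

/-- The closed facets of the reference element. -/
def Shape.refFacet : (s : Shape) → (d : ℕ) → s.Facet d → Set (E d)
  | .simplex, _, some i => {x | (∀ j, 0 ≤ x j) ∧ ∑ j, x j ≤ 1 ∧ x i = 0}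
  | .simplex, _, none => {x | (∀ j, 0 ≤ x j) ∧ ∑ j, x j = 1}
  | .cube, _, (i, false) => {x | (∀ j, 0 ≤ x j ∧ x j ≤ 1) ∧ x i = 0}
  | .cube, _, (i, true) => {x | (∀ j, 0 ≤ x j ∧ x j ≤ 1) ∧ x i = 1}

/-- A polynomial in `d` variables as a function on `ℝᵈ`. -/
def evalFun (d : ℕ) : MvPolynomial (Fin d) ℝ →ₗ[ℝ] (E d → ℝ) where
  toFun q := fun x => MvPolynomial.eval (fun i => x i) q
  map_add' p q := by ext x; simp
  map_smul' c q := by ext x; simp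

/-- The local space `𝕄ᵖ`: polynomials of total degree at most `p` (simplex), respectively of degree
at most `p` in each coordinate (hypercube). -/
def Shape.poly : Shape → (d p : ℕ) → Submodule ℝ (E d → ℝ)
  | .simplex, d, p => (MvPolynomial.restrictTotalDegree (Fin d) ℝ p).map (evalFun d)
  | .cube, d, p => (MvPolynomial.restrictDegree (Fin d) ℝ p).map (evalFun d)

instance (s : Shape) (d p : ℕ) : FiniteDimensional ℝ (s.poly d p) := by
  cases s <;> unfold Shape.poly <;> infer_instance

lemma Shape.poly_le_range (s : Shape) (d p : ℕ) : s.poly d p ≤ LinearMap.range (evalFun d) := by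
  cases s <;> exact LinearMap.map_le_range

lemma Shape.poly_mono (s : Shape) (d : ℕ) {p p' : ℕ} (h : p ≤ p') :
    s.poly d p ≤ s.poly d p' := by
  cases s <;> refine Submodule.map_mono fun q hq => ?_
  · rw [MvPolynomial.mem_restrictTotalDegree] at *
    exact hq.trans h
  · rw [MvPolynomial.mem_restrictDegree] at *
    exact fun a ha i => (hq a ha i).trans h

lemma contDiff_evalFun {d : ℕ} (q : MvPolynomial (Fin d) ℝ) : ContDiff ℝ 1 (evalFun d q) := by
  induction q using MvPolynomial.induction_on with
  | C a => simpa [evalFun] using contDiff_const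
  | add p q hp hq => rw [map_add]; exact hp.add hq
  | mul_X p i hp =>
    have : evalFun d (p * MvPolynomial.X i) = fun x => evalFun d p x * x i := by
      ext x; simp [evalFun]
    rw [this]
    exact hp.mul (by fun_prop)

lemma Shape.ref_isOpen (s : Shape) (d : ℕ) : IsOpen (s.ref d) := by
  cases s
  · have : Shape.simplex.ref d = (⋂ i : Fin d, {x : E d | 0 < x i}) ∩ {x | ∑ i, x i < 1} := by
      ext x; simp [Shape.ref]
    rw [this]
    exact (isOpen_iInter_of_finite fun i => isOpen_lt (by fun_prop) (by fun_prop)).inter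
      (isOpen_lt (by fun_prop) (by fun_prop))
  · have : Shape.cube.ref d = (⋂ i : Fin d, {x : E d | 0 < x i} ∩ {x | x i < 1}) := by
      ext x; simp [Shape.ref]
    rw [this]
    exact isOpen_iInter_of_finite fun i => (isOpen_lt (by fun_prop) (by fun_prop)).inter
      (isOpen_lt (by fun_prop) (by fun_prop))

lemma Shape.ref_convex (s : Shape) (d : ℕ) : Convex ℝ (s.ref d) := by
  cases s
  · rintro x ⟨hx, hx1⟩ y ⟨hy, hy1⟩ a b ha hb hab
    refine ⟨fun i => ?_, ?_⟩
    · have := (convex_Ioi (0:ℝ)) (hx i) (hy i) ha hb hab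
      simpa using this
    · have := (convex_Iio (1:ℝ)) hx1 hy1 ha hb hab
      simpa [Finset.sum_add_distrib, Finset.mul_sum] using this
  · rintro x hx y hy a b ha hb hab i
    have := (convex_Ioo (0:ℝ) 1) (hx i) (hy i) ha hb hab
    simpa using this

lemma isBounded_of_coord {d : ℕ} {S : Set (E d)} (h : ∀ x ∈ S, ∀ i, 0 ≤ x i ∧ x i ≤ 1) :
    Bornology.IsBounded S := by
  refine (Metric.isBounded_iff_subset_closedBall 0).2 ⟨√(d : ℝ), fun x hx => ?_⟩
  rw [mem_closedBall_zero_iff, EuclideanSpace.norm_eq]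
  refine Real.sqrt_le_sqrt ?_
  calc ∑ i, ‖x i‖ ^ 2 ≤ ∑ _i : Fin d, (1:ℝ) := Finset.sum_le_sum fun i _ => by
        rw [Real.norm_eq_abs, sq_abs]; nlinarith [h x hx i]
    _ = d := by simp

lemma Shape.ref_coord (s : Shape) (d : ℕ) : ∀ x ∈ s.ref d, ∀ i, 0 ≤ x i ∧ x i ≤ 1 := by
  cases s
  · rintro x ⟨hx, hx1⟩ i
    refine ⟨(hx i).le, le_trans ?_ hx1.le⟩
    exact Finset.single_le_sum (f := fun i => x i) (fun j _ => (hx j).le) (Finset.mem_univ i)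
  · exact fun x hx i => ⟨(hx i).1.le, (hx i).2.le⟩

lemma Shape.refFacet_coord (s : Shape) (d : ℕ) (a : s.Facet d) :
    ∀ x ∈ s.refFacet d a, ∀ i, 0 ≤ x i ∧ x i ≤ 1 := by
  cases s
  · rcases a with _ | a
    · rintro x ⟨hx, hx1⟩ i
      refine ⟨hx i, le_trans ?_ hx1.le⟩
      exact Finset.single_le_sum (f := fun i => x i) (fun j _ => hx j) (Finset.mem_univ i)
    · rintro x ⟨hx, hx1, -⟩ i
      refine ⟨hx i, le_trans ?_ hx1⟩
      exact Finset.single_le_sum (f := fun i => x i) (fun j _ => hx j) (Finset.mem_univ i)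
  · rcases a with ⟨a, _ | _⟩ <;> exact fun x hx i => hx.1 i

lemma Shape.box_subset_ref (s : Shape) (d : ℕ) :
    ∀ x : E d, (∀ i, x i ∈ Ioo (0:ℝ) (1 / (d + 1))) → x ∈ s.ref d := by
  intro x hx
  have hd : (0:ℝ) < d + 1 := by positivity
  cases s
  · refine ⟨fun i => (hx i).1, ?_⟩
    calc ∑ i, x i ≤ ∑ _i : Fin d, (1:ℝ) / (d + 1) := Finset.sum_le_sum fun i _ => (hx i).2.le
      _ = d / (d + 1) := by simp [div_eq_mul_inv]
      _ < 1 := by rw [div_lt_one hd]; linarith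
  · refine fun i => ⟨(hx i).1, (hx i).2.trans_le ?_⟩
    rw [div_le_one hd]; linarith [(Nat.cast_nonneg d : (0:ℝ) ≤ d)]

lemma Shape.ref_nonempty (s : Shape) (d : ℕ) : (s.ref d).Nonempty := by
  refine ⟨WithLp.toLp 2 fun _ => 1 / (d + 2), s.box_subset_ref d _ fun i => ?_⟩
  have : (0:ℝ) ≤ d := Nat.cast_nonneg d
  constructor
  · simp only; positivity
  · simp only; gcongr; linarith

lemma eq_zero_of_ref {s : Shape} {d p : ℕ} {f : E d → ℝ} (hf : f ∈ s.poly d p)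
    (h : ∀ x ∈ s.ref d, f x = 0) : f = 0 := by
  obtain ⟨q, rfl⟩ := s.poly_le_range d p hf
  have : q = 0 := by
    refine MvPolynomial.funext_set (fun _ => Ioo (0:ℝ) (1 / (d + 1)))
      (fun _ => Ioo_infinite (by positivity)) fun x hx => ?_
    have := h (WithLp.toLp 2 x) (s.box_subset_ref d _ fun i => hx i trivial)
    simpa [evalFun] using this
  rw [this, map_zero]

/-- A bounded subset of a hyperplane has finite surface measure. -/
lemma surf_lt_top {d : ℕ} {S : Set (E d)} (hS : Bornology.IsBounded S) (f : E d →ₗ[ℝ] ℝ)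
    (hf : f ≠ 0) (c : ℝ) (h : ∀ x ∈ S, f x = c) :
    (Measure.euclideanHausdorffMeasure (d - 1) : Measure (E d)) S < ⊤ := by
  rcases S.eq_empty_or_nonempty with rfl | ⟨x₀, hx₀⟩
  · simp
  let g : LinearMap.ker f → E d := fun y => x₀ + (y : E d)
  have hg : Isometry g := fun y z => by simp [g, Subtype.edist_eq]
  have hSg : S = g '' (g ⁻¹' S) := by
    rw [image_preimage_eq_inter_range, eq_comm, inter_eq_left]
    intro x hx
    refine ⟨⟨x - x₀, ?_⟩, by simp [g]⟩
    simp [h x hx, h x₀ hx₀]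
  have hfin : Module.finrank ℝ (LinearMap.ker f) = d - 1 := by
    have h1 := f.finrank_range_add_finrank_ker
    rw [LinearMap.range_eq_top.2 (LinearMap.surjective_of_ne_zero hf)] at h1
    simp at h1
    omega
  rw [hSg, hg.euclideanHausdorffMeasure_image, ← hfin]
  refine Bornology.IsBounded.measure_lt_top ?_
  exact hg.antilipschitz.isBounded_preimage hS


lemma Shape.refFacet_hyperplane (s : Shape) (d : ℕ) (a : s.Facet d) :
    ∃ (f : E d →ₗ[ℝ] ℝ) (c : ℝ), (s.refFacet d a = ∅ ∨ f ≠ 0) ∧ ∀ x ∈ s.refFacet d a, f x = c := by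
  have key : ∀ i : Fin d, (EuclideanSpace.proj i : E d →L[ℝ] ℝ).toLinearMap ≠ 0 := fun i h => by
    have := LinearMap.congr_fun h (EuclideanSpace.single i 1)
    simp at this
  cases s
  · rcases a with _ | i
    · refine ⟨∑ i, (EuclideanSpace.proj i : E d →L[ℝ] ℝ).toLinearMap, 1, ?_, fun x hx => ?_⟩
      · rcases Nat.eq_zero_or_pos d with rfl | hd
        · left
          ext x
          simp [Shape.refFacet]
        · right
          intro h
          have := LinearMap.congr_fun h (EuclideanSpace.single ⟨0, hd⟩ 1)
          simp [LinearMap.sum_apply] at this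
      · simpa [LinearMap.sum_apply] using hx.2
    · exact ⟨_, 0, Or.inr (key i), fun x hx => hx.2.2⟩
  · rcases a with ⟨i, _ | _⟩
    · exact ⟨_, 0, Or.inr (key i), fun x hx => hx.2⟩
    · exact ⟨_, 1, Or.inr (key i), fun x hx => hx.2⟩

lemma Shape.refFacet_isClosed (s : Shape) (d : ℕ) (a : s.Facet d) :
    IsClosed (s.refFacet d a) := by
  cases s
  · rcases a with _ | i
    · have : Shape.simplex.refFacet d none =
          (⋂ i : Fin d, {x : E d | 0 ≤ x i}) ∩ {x | ∑ i, x i = 1} := by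
        ext x; simp [Shape.refFacet]
      exact this ▸ (isClosed_iInter fun i => isClosed_le (by fun_prop) (by fun_prop)).inter
        (isClosed_eq (by fun_prop) (by fun_prop))
    · have : Shape.simplex.refFacet d (some i) =
          (⋂ i : Fin d, {x : E d | 0 ≤ x i}) ∩ ({x | ∑ i, x i ≤ 1} ∩ {x | x i = 0}) := by
        ext x; simp [Shape.refFacet]
      exact this ▸ (isClosed_iInter fun i => isClosed_le (by fun_prop) (by fun_prop)).inter
        ((isClosed_le (by fun_prop) (by fun_prop)).inter (isClosed_eq (by fun_prop) (by fun_prop)))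
  · have hbox : IsClosed {x : E d | ∀ j, 0 ≤ x j ∧ x j ≤ 1} := by
      have : {x : E d | ∀ j, 0 ≤ x j ∧ x j ≤ 1} =
          ⋂ j : Fin d, {x : E d | 0 ≤ x j} ∩ {x | x j ≤ 1} := by
        ext x; simp
      exact this ▸ isClosed_iInter fun i => (isClosed_le (by fun_prop) (by fun_prop)).inter
        (isClosed_le (by fun_prop) (by fun_prop))
    rcases a with ⟨i, _ | _⟩
    · exact hbox.inter (isClosed_eq (by fun_prop) (by fun_prop) : IsClosed {x : E d | x i = 0})
    · exact hbox.inter (isClosed_eq (by fun_prop) (by fun_prop) : IsClosed {x : E d | x i = 1})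

/-- A partition of `Ω` (up to a null set) into finitely many pairwise disjoint open elements
`T = F_T(T̂)`, the images of the reference element under invertible affine maps. -/
structure Mesh (s : Shape) (d : ℕ) (Ω : Set (E d)) where
  N : ℕ
  F : Fin N → (E d ≃ᵃ[ℝ] E d)
  disjoint : Pairwise fun i j => Disjoint (F i '' s.ref d) (F j '' s.ref d)
  cover : ⋃ i, closure (F i '' s.ref d) = closure Ω

namespace Mesh

variable {s : Shape} {d : ℕ} {Ω : Set (E d)} (𝒯 : Mesh s d Ω)

/-- The element `T`, an open simplex or parallelepiped. -/
def elt (T : Fin 𝒯.N) : Set (E d) := 𝒯.F T '' s.ref d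

/-- The diameter `h_T`. -/
def diam (T : Fin 𝒯.N) : ℝ := Metric.diam (𝒯.elt T)

/-- The mesh size `h = max_T h_T`. -/
def size : ℝ := ⨆ T, 𝒯.diam T

/-- Interior faces are labelled by the pairs of distinct elements `T⁺, T⁻` (each unordered pair
once). A pair whose closures meet in a set of dimension less than `d - 1` contributes only integrals
over a null set, that is, nothing. -/
abbrev IFace : Type := {P : Fin 𝒯.N × Fin 𝒯.N // P.1 < P.2}

/-- The interior face: the intersection of the closures of two elements. -/
def iface (F : 𝒯.IFace) : Set (E d) := closure (𝒯.elt F.1.1) ∩ closure (𝒯.elt F.1.2)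

/-- Boundary faces are labelled by the facets of the elements; a facet that does not lie on `∂Ω`
contributes only integrals over a null set. -/
abbrev BFace : Type := Fin 𝒯.N × s.Facet d

/-- A closed facet of an element. -/
def facet (F : 𝒯.BFace) : Set (E d) := 𝒯.F F.1 '' s.refFacet d F.2

/-- The boundary face: the part of a facet that lies on `∂Ω`. -/
def bface (F : 𝒯.BFace) : Set (E d) := 𝒯.facet F ∩ frontier Ω

end Mesh

/-- The unit normal to the flat piece `S` of the boundary of the convex open set `T`, pointing out of
`T`. It is unique as soon as `S` has positive surface measure. -/
def outerNormal {d : ℕ} (T S : Set (E d)) : E d :=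
  Classical.epsilon fun n => ‖n‖ = 1 ∧ ∀ x ∈ S, ∀ y ∈ T, inner ℝ n (y - x) < 0

namespace Mesh

variable {s : Shape} {d : ℕ} {Ω : Set (E d)} (𝒯 : Mesh s d Ω)

/-- The outward normal of `T⁺` on an interior face. -/
def nPlus (F : 𝒯.IFace) : E d := outerNormal (𝒯.elt F.1.1) (𝒯.iface F)

/-- The outward normal of `T⁻` on an interior face. -/
def nMinus (F : 𝒯.IFace) : E d := outerNormal (𝒯.elt F.1.2) (𝒯.iface F)

/-- The outward normal on a boundary face. -/
def nBdry (F : 𝒯.BFace) : E d := outerNormal (𝒯.elt F.1) (𝒯.facet F)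

lemma continuous_F (T : Fin 𝒯.N) : Continuous (𝒯.F T) :=
  AffineMap.continuous_of_finiteDimensional (𝒯.F T).toAffineMap

lemma continuous_F_symm (T : Fin 𝒯.N) : Continuous (𝒯.F T).symm :=
  AffineMap.continuous_of_finiteDimensional (𝒯.F T).symm.toAffineMap

lemma elt_isOpen (T : Fin 𝒯.N) : IsOpen (𝒯.elt T) := by
  have : 𝒯.elt T = (𝒯.F T).symm ⁻¹' s.ref d := by
    ext x
    constructor
    · rintro ⟨y, hy, rfl⟩; simpa using hy
    · intro hx; exact ⟨_, hx, by simp⟩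
  rw [this]
  exact (s.ref_isOpen d).preimage (𝒯.continuous_F_symm T)

lemma elt_nonempty (T : Fin 𝒯.N) : (𝒯.elt T).Nonempty := (s.ref_nonempty d).image _

lemma elt_convex (T : Fin 𝒯.N) : Convex ℝ (𝒯.elt T) :=
  (s.ref_convex d).affine_image (𝒯.F T).toAffineMap

lemma isBounded_image (T : Fin 𝒯.N) {S : Set (E d)} (hS : Bornology.IsBounded S) :
    Bornology.IsBounded (𝒯.F T '' S) :=
  ((hS.isCompact_closure.image (𝒯.continuous_F T)).isBounded).subset
    (image_mono subset_closure)

lemma elt_isBounded (T : Fin 𝒯.N) : Bornology.IsBounded (𝒯.elt T) :=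
  𝒯.isBounded_image T (isBounded_of_coord (s.ref_coord d))

lemma iface_isCompact (F : 𝒯.IFace) : IsCompact (𝒯.iface F) :=
  (𝒯.elt_isBounded F.1.1).isCompact_closure.inter_right isClosed_closure

lemma facet_isCompact (F : 𝒯.BFace) : IsCompact (𝒯.facet F) :=
  (Metric.isCompact_of_isClosed_isBounded (s.refFacet_isClosed d F.2)
    (isBounded_of_coord (s.refFacet_coord d F.2))).image (𝒯.continuous_F F.1)

lemma bface_isCompact (F : 𝒯.BFace) : IsCompact (𝒯.bface F) :=
  (𝒯.facet_isCompact F).inter_right isClosed_frontier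

end Mesh

/-- Surface measure: the `(d - 1)`-dimensional Hausdorff measure, normalized so that it is Lebesgue
measure on hyperplanes. -/
abbrev surf (d : ℕ) : Measure (E d) := Measure.euclideanHausdorffMeasure (d - 1)

namespace Mesh

variable {s : Shape} {d : ℕ} {Ω : Set (E d)} (𝒯 : Mesh s d Ω)

lemma surf_iface_lt_top (F : 𝒯.IFace) : surf d (𝒯.iface F) < ⊤ := by
  obtain ⟨f, u, h1, h2⟩ := geometric_hahn_banach_open_open (𝒯.elt_convex F.1.1)
    (𝒯.elt_isOpen F.1.1) (𝒯.elt_convex F.1.2) (𝒯.elt_isOpen F.1.2) (𝒯.disjoint F.2.ne)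
  refine surf_lt_top (𝒯.iface_isCompact F).isBounded f.toLinearMap ?_ u fun x hx => ?_
  · intro h
    obtain ⟨x, hx⟩ := 𝒯.elt_nonempty F.1.1
    obtain ⟨y, hy⟩ := 𝒯.elt_nonempty F.1.2
    have hx1 := h1 x hx
    have hy1 := h2 y hy
    have hx0 : f x = 0 := LinearMap.congr_fun h x
    have hy0 : f y = 0 := LinearMap.congr_fun h y
    linarith
  · refine le_antisymm ?_ ?_
    · exact closure_minimal (fun y hy => (h1 y hy).le)
        (isClosed_le f.continuous continuous_const) hx.1
    · exact closure_minimal (fun y hy => (h2 y hy).le)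
        (isClosed_le continuous_const f.continuous) hx.2

lemma surf_bface_lt_top (F : 𝒯.BFace) : surf d (𝒯.bface F) < ⊤ := by
  refine lt_of_le_of_lt (measure_mono inter_subset_left) ?_
  obtain ⟨f, c, h, hc⟩ := s.refFacet_hyperplane d F.2
  rcases h with h | h
  · simp [facet, h]
  let L := (𝒯.F F.1).symm.linear
  refine surf_lt_top (𝒯.facet_isCompact F).isBounded (f ∘ₗ L.toLinearMap) ?_
    (c - f ((𝒯.F F.1).symm 0)) ?_
  · intro h0
    apply h
    ext x
    have := LinearMap.congr_fun h0 (L.symm x)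
    simpa using this
  · rintro _ ⟨x, hx, rfl⟩
    have h1 : L (𝒯.F F.1 x) = x - (𝒯.F F.1).symm 0 := by
      have := (𝒯.F F.1).symm.toAffineMap.linearMap_vsub (𝒯.F F.1 x) 0
      simpa [L] using this
    simp [h1, hc x hx]

end Mesh


/-- The bilinear map `(f, g) ↦ ∫_S f · g dμ` on continuous functions, for a bounded measurable set `S`
of finite measure. -/
def intPair {d : ℕ} {W : Type*} [NormedAddCommGroup W] [InnerProductSpace ℝ W]
    (μ : Measure (E d)) (S : Set (E d)) (hb : Bornology.IsBounded S) (hm : MeasurableSet S)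
    (hμ : μ S < ⊤) : C(E d, W) →ₗ[ℝ] C(E d, W) →ₗ[ℝ] ℝ :=
  have hint : ∀ f g : C(E d, W), IntegrableOn (fun x => inner ℝ (f x) (g x)) S μ := by
    intro f g
    have hc : Continuous fun x => inner ℝ (f x) (g x) := f.continuous.inner g.continuous
    obtain ⟨C, hC⟩ := (hb.isCompact_closure.image hc).isBounded.exists_norm_le
    refine Measure.integrableOn_of_bounded (M := C) hμ.ne hc.aestronglyMeasurable ?_
    refine ae_restrict_of_forall_mem hm fun x hx => ?_
    exact hC _ (mem_image_of_mem _ (subset_closure hx))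
  LinearMap.mk₂ ℝ (fun f g => ∫ x in S, inner ℝ (f x) (g x) ∂μ)
    (fun f f' g => by
      simp only [ContinuousMap.add_apply, inner_add_left]
      exact integral_add (hint f g) (hint f' g))
    (fun c f g => by
      simp only [ContinuousMap.smul_apply, real_inner_smul_left, smul_eq_mul]
      exact integral_const_mul c _)
    (fun f g g' => by
      simp only [ContinuousMap.add_apply, inner_add_right]
      exact integral_add (hint f g) (hint f g'))
    (fun c f g => by
      simp only [ContinuousMap.smul_apply, real_inner_smul_right, smul_eq_mul]
      exact integral_const_mul c _)

lemma intPair_apply {d : ℕ} {W : Type*} [NormedAddCommGroup W] [InnerProductSpace ℝ W]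
    (μ : Measure (E d)) (S : Set (E d)) (hb : Bornology.IsBounded S) (hm : MeasurableSet S)
    (hμ : μ S < ⊤) (f g : C(E d, W)) :
    intPair μ S hb hm hμ f g = ∫ x in S, inner ℝ (f x) (g x) ∂μ := rfl

namespace Mesh

variable {s : Shape} {d : ℕ} {Ω : Set (E d)} (𝒯 : Mesh s d Ω)

/-- `∫_T f · g dx`. -/
def intElt {W : Type*} [NormedAddCommGroup W] [InnerProductSpace ℝ W] (T : Fin 𝒯.N) :
    C(E d, W) →ₗ[ℝ] C(E d, W) →ₗ[ℝ] ℝ :=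
  intPair volume (𝒯.elt T) (𝒯.elt_isBounded T) (𝒯.elt_isOpen T).measurableSet
    (𝒯.elt_isBounded T).measure_lt_top

/-- `∫_F f · g ds` over an interior face. -/
def intI {W : Type*} [NormedAddCommGroup W] [InnerProductSpace ℝ W] (F : 𝒯.IFace) :
    C(E d, W) →ₗ[ℝ] C(E d, W) →ₗ[ℝ] ℝ :=
  intPair (surf d) (𝒯.iface F) (𝒯.iface_isCompact F).isBounded (𝒯.iface_isCompact F).measurableSet
    (𝒯.surf_iface_lt_top F)

/-- `∫_F f · g ds` over a boundary face. -/
def intB {W : Type*} [NormedAddCommGroup W] [InnerProductSpace ℝ W] (F : 𝒯.BFace) :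
    C(E d, W) →ₗ[ℝ] C(E d, W) →ₗ[ℝ] ℝ :=
  intPair (surf d) (𝒯.bface F) (𝒯.bface_isCompact F).isBounded (𝒯.bface_isCompact F).measurableSet
    (𝒯.surf_bface_lt_top F)

/-- The discontinuous finite element space: `v ∘ F_T ∈ 𝕄ᵖ` on every element. A member `v` is given by
its polynomial pieces `v T`; as a function on `Ω` it equals `v T` on the element `T`, and the trace on
`∂T` from within `T` is the restriction of the polynomial `v T`. -/
def V (p : ℕ) : Submodule ℝ (Fin 𝒯.N → E d → ℝ) where
  carrier := {v | ∀ T, v T ∘ 𝒯.F T ∈ s.poly d p}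
  add_mem' hu hv T := (s.poly d p).add_mem (hu T) (hv T)
  zero_mem' _ := (s.poly d p).zero_mem
  smul_mem' c _ hv T := (s.poly d p).smul_mem c (hv T)

/-- The pieces of `v` on the reference element, `v ↦ (v ∘ F_T)_T`. -/
def pullback (p : ℕ) : 𝒯.V p ≃ₗ[ℝ] (Fin 𝒯.N → s.poly d p) where
  toFun v T := ⟨v.1 T ∘ 𝒯.F T, v.2 T⟩
  map_add' _ _ := rfl
  map_smul' _ _ := rfl
  invFun q := ⟨fun T => (q T).1 ∘ (𝒯.F T).symm, fun T => by
    have : ((q T).1 ∘ (𝒯.F T).symm) ∘ 𝒯.F T = (q T).1 := by ext x; simp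
    exact this ▸ (q T).2⟩
  left_inv v := by ext T x; simp
  right_inv q := by ext T x; simp

instance (p : ℕ) : FiniteDimensional ℝ (𝒯.V p) :=
  Module.Finite.equiv (𝒯.pullback p).symm

variable {𝒯} {p : ℕ}

lemma contDiff_V (v : 𝒯.V p) (T : Fin 𝒯.N) : ContDiff ℝ 1 (v.1 T) := by
  obtain ⟨q, hq⟩ := s.poly_le_range d p (v.2 T)
  have h : v.1 T = evalFun d q ∘ (𝒯.F T).symm := by
    rw [hq]; ext x; simp
  rw [h]
  refine (contDiff_evalFun q).comp ?_
  have hA : ((𝒯.F T).symm : E d → E d) =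
      fun x => LinearMap.toContinuousLinearMap (𝒯.F T).symm.linear.toLinearMap x
        + (𝒯.F T).symm 0 := by
    ext1 x
    have := (𝒯.F T).symm.toAffineMap.linearMap_vsub x 0
    simp only [vsub_eq_sub, sub_zero] at this
    simp [← sub_eq_iff_eq_add]
    simpa using this.symm
  rw [hA]
  fun_prop

/-- Vector-valued discontinuous functions, `[V]ᵈ`. -/
abbrev VV (𝒯 : Mesh s d Ω) (p : ℕ) : Type := Fin d → 𝒯.V p

/-- The polynomial `v|_T`. -/
def val (T : Fin 𝒯.N) : 𝒯.V p →ₗ[ℝ] C(E d, ℝ) where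
  toFun v := ⟨v.1 T, (contDiff_V v T).continuous⟩
  map_add' _ _ := rfl
  map_smul' _ _ := rfl

/-- The vector field `η|_T`. -/
def vec (T : Fin 𝒯.N) : 𝒯.VV p →ₗ[ℝ] C(E d, E d) where
  toFun η := ⟨fun x => WithLp.toLp 2 fun c => (η c).1 T x, by
    have := fun c => (contDiff_V (η c) T).continuous
    fun_prop⟩
  map_add' _ _ := rfl
  map_smul' _ _ := rfl

/-- The gradient of `v|_T`. -/
def grad (T : Fin 𝒯.N) : 𝒯.V p →ₗ[ℝ] C(E d, E d) where
  toFun v := ⟨gradient (v.1 T), by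
    have := (contDiff_V v T).continuous_fderiv (by norm_num)
    unfold gradient
    fun_prop⟩
  map_add' u v := by
    ext1 x
    have hu := ((contDiff_V u T).differentiable (by norm_num)) x
    have hv := ((contDiff_V v T).differentiable (by norm_num)) x
    have : (u + v).1 T = u.1 T + v.1 T := rfl
    simp [gradient, this, fderiv_add hu hv]
  map_smul' c v := by
    ext1 x
    have hv := ((contDiff_V v T).differentiable (by norm_num)) x
    have : (c • v).1 T = c • v.1 T := rfl
    simp [gradient, this, fderiv_const_smul hv]

/-- The jump `⟦v⟧ = v⁺ n⁺ + v⁻ n⁻` on an interior face. -/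
def jumpI (F : 𝒯.IFace) : 𝒯.V p →ₗ[ℝ] C(E d, E d) where
  toFun v := ⟨fun x => val F.1.1 v x • 𝒯.nPlus F + val F.1.2 v x • 𝒯.nMinus F, by fun_prop⟩
  map_add' u v := by ext1 x; simp [add_smul]; abel
  map_smul' c v := by ext1 x; simp [smul_smul]

/-- The jump `⟦v⟧ = v n` on a boundary face. -/
def jumpB (F : 𝒯.BFace) : 𝒯.V p →ₗ[ℝ] C(E d, E d) where
  toFun v := ⟨fun x => val F.1 v x • 𝒯.nBdry F, by fun_prop⟩
  map_add' u v := by ext1 x; simp [add_smul]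
  map_smul' c v := by ext1 x; simp [smul_smul]

/-- The average `{η} = (η⁺ + η⁻) / 2` on an interior face. -/
def avgI (F : 𝒯.IFace) : 𝒯.VV p →ₗ[ℝ] C(E d, E d) where
  toFun η := ⟨fun x => (1 / 2 : ℝ) • (vec F.1.1 η x + vec F.1.2 η x), by fun_prop⟩
  map_add' u v := by ext1 x; simp; abel
  map_smul' c v := by ext1 x; simp [smul_smul, mul_comm]

/-- The jump `⟦η⟧ = η⁺ · n⁺ + η⁻ · n⁻` of a vector field on an interior face. -/
def vjumpI (F : 𝒯.IFace) : 𝒯.VV p →ₗ[ℝ] C(E d, ℝ) where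
  toFun η := ⟨fun x => inner ℝ (vec F.1.1 η x) (𝒯.nPlus F) + inner ℝ (vec F.1.2 η x) (𝒯.nMinus F),
    by fun_prop⟩
  map_add' u v := by ext1 x; simp [inner_add_left]; ring
  map_smul' c v := by ext1 x; simp [real_inner_smul_left]; ring

/-- The scalar function `β · ⟦v⟧` on an interior face. -/
def betaJump (β : E d) (F : 𝒯.IFace) : 𝒯.V p →ₗ[ℝ] C(E d, ℝ) where
  toFun v := ⟨fun x => inner ℝ β (jumpI F v x), by fun_prop⟩
  map_add' u v := by ext1 x; simp [inner_add_right]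
  map_smul' c v := by ext1 x; simp [real_inner_smul_right]

/-- The `L²(Ω)` inner product on `[V]ᵈ`. -/
def l2 (𝒯 : Mesh s d Ω) (p : ℕ) : LinearMap.BilinForm ℝ (𝒯.VV p) :=
  ∑ T, (𝒯.intElt T).compl₁₂ (vec T) (vec T)

lemma l2_apply (ζ η : 𝒯.VV p) :
    l2 𝒯 p ζ η = ∑ T, ∫ x in 𝒯.elt T, inner ℝ (vec T ζ x) (vec T η x) := by
  simp [l2, LinearMap.sum_apply, intElt, intPair_apply]

lemma eq_zero_of_elt (v : 𝒯.V p) (h : ∀ T, ∀ x ∈ 𝒯.elt T, v.1 T x = 0) : v = 0 := by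
  apply (𝒯.pullback p).injective
  rw [map_zero]
  ext1 T
  apply Subtype.ext
  exact eq_zero_of_ref (v.2 T) fun x hx => h T _ (mem_image_of_mem _ hx)

lemma l2_nondegenerate : (l2 𝒯 p).Nondegenerate := by
  have hsymm : ∀ ζ η, l2 𝒯 p ζ η = l2 𝒯 p η ζ := fun ζ η => by
    simp only [l2_apply, real_inner_comm]
  have hdef : ∀ ζ, l2 𝒯 p ζ ζ = 0 → ζ = 0 := by
    intro ζ h
    rw [l2_apply, Finset.sum_eq_zero_iff_of_nonneg] at h
    · funext c
      refine eq_zero_of_elt _ fun T x hx => ?_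
      have hc : Continuous fun x => inner ℝ (vec T ζ x) (vec T ζ x) := by fun_prop
      have hT := h T (Finset.mem_univ T)
      rw [setIntegral_eq_zero_iff_of_nonneg_ae] at hT
      · have := (MeasureTheory.Measure.eqOn_open_of_ae_eq hT (𝒯.elt_isOpen T) hc.continuousOn
          continuousOn_const) hx
        simp only [Pi.zero_apply, inner_self_eq_zero] at this
        exact congrArg (fun z : E d => z c) this
      · exact Filter.Eventually.of_forall fun x => real_inner_self_nonneg
      · exact (hc.continuousOn.integrableOn_compact
          (𝒯.elt_isBounded T).isCompact_closure).mono_set subset_closure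
    · exact fun T _ => integral_nonneg fun x => real_inner_self_nonneg
  refine ⟨fun ζ h => hdef ζ (h ζ), fun ζ h => hdef ζ (h ζ)⟩


/-- The lifting `r_F(⟦v⟧) ∈ [V]ᵈ` on an interior face:
`∫_Ω r_F(⟦v⟧) · η dx = - ∫_F ⟦v⟧ · {η} ds` for all `η ∈ [V]ᵈ`. -/
def liftR (F : 𝒯.IFace) : 𝒯.V p →ₗ[ℝ] 𝒯.VV p :=
  -(((l2 𝒯 p).toDual l2_nondegenerate).symm.toLinearMap ∘ₗ (𝒯.intI F).compl₁₂ (jumpI F) (avgI F))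

/-- The lifting `r_F(⟦v⟧) ∈ [V]ᵈ` on a boundary face, where `{η} = η`. -/
def liftRB (F : 𝒯.BFace) : 𝒯.V p →ₗ[ℝ] 𝒯.VV p :=
  -(((l2 𝒯 p).toDual l2_nondegenerate).symm.toLinearMap ∘ₗ (𝒯.intB F).compl₁₂ (jumpB F) (vec F.1))

/-- The lifting `l_F(β · ⟦v⟧) ∈ [V]ᵈ` on an interior face:
`∫_Ω l_F(β · ⟦v⟧) · η dx = - ∫_F (β · ⟦v⟧) ⟦η⟧ ds` for all `η ∈ [V]ᵈ`. -/
def liftL (β : E d) (F : 𝒯.IFace) : 𝒯.V p →ₗ[ℝ] 𝒯.VV p :=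
  -(((l2 𝒯 p).toDual l2_nondegenerate).symm.toLinearMap ∘ₗ
    (𝒯.intI F).compl₁₂ (betaJump β F) (vjumpI F))

lemma l2_liftR (F : 𝒯.IFace) (v : 𝒯.V p) (η : 𝒯.VV p) :
    l2 𝒯 p (liftR F v) η = -∫ x in 𝒯.iface F, inner ℝ (jumpI F v x) (avgI F η x) ∂(surf d) := by
  simp [liftR, intI, intPair_apply, LinearMap.BilinForm.apply_toDual_symm_apply]

lemma l2_liftRB (F : 𝒯.BFace) (v : 𝒯.V p) (η : 𝒯.VV p) :
    l2 𝒯 p (liftRB F v) η = -∫ x in 𝒯.bface F, inner ℝ (jumpB F v x) (vec F.1 η x) ∂(surf d) := by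
  simp [liftRB, intB, intPair_apply, LinearMap.BilinForm.apply_toDual_symm_apply]

lemma l2_liftL (β : E d) (F : 𝒯.IFace) (v : 𝒯.V p) (η : 𝒯.VV p) :
    l2 𝒯 p (liftL β F v) η =
      -∫ x in 𝒯.iface F, betaJump β F v x * vjumpI F η x ∂(surf d) := by
  simp [liftL, intI, intPair_apply, LinearMap.BilinForm.apply_toDual_symm_apply, mul_comm]

end Mesh

/-- The discontinuous Galerkin methods: SIPG, SIPG(δ) with a weight `δ ∈ [0, 1]` on each face, and LDG
with a vector `β` on each face. -/
inductive DGMethod {s : Shape} {d : ℕ} {Ω : Set (E d)} (𝒯 : Mesh s d Ω) where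
  | sipg
  | sipgDelta (δ : 𝒯.IFace → Icc (0 : ℝ) 1)
  | ldg (β : 𝒯.IFace → E d)

namespace DGMethod

variable {s : Shape} {d : ℕ} {Ω : Set (E d)} {𝒯 : Mesh s d Ω}

/-- The parameter `θ`. -/
def θ : DGMethod 𝒯 → ℝ
  | sipg => 0
  | sipgDelta _ => 0
  | ldg _ => 1

/-- The vector `β` on an interior face; for SIPG(δ) it is `(δ - 1/2) n⁺`. -/
def β : DGMethod 𝒯 → 𝒯.IFace → E d
  | sipg, _ => 0
  | sipgDelta δ, F => ((δ F : ℝ) - 1 / 2) • 𝒯.nPlus F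
  | ldg β, F => β F

end DGMethod

namespace Mesh

variable {s : Shape} {d : ℕ} {Ω : Set (E d)} (𝒯 : Mesh s d Ω) (p : ℕ) (α : ℝ)

/-- The penalty `α p² / min(h_{T⁺}, h_{T⁻})` on an interior face. -/
def σI (F : 𝒯.IFace) : ℝ := α * (p : ℝ) ^ 2 / min (𝒯.diam F.1.1) (𝒯.diam F.1.2)

/-- The penalty `α p² / h_T` on a boundary face. -/
def σB (F : 𝒯.BFace) : ℝ := α * (p : ℝ) ^ 2 / 𝒯.diam F.1

/-- The stabilization term `∑_F ∫_F σ ⟦w⟧ · ⟦v⟧ ds`. -/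
def stab : LinearMap.BilinForm ℝ (𝒯.V p) :=
  ∑ F, 𝒯.σI p α F • (𝒯.intI F).compl₁₂ (jumpI F) (jumpI F) +
    ∑ F, 𝒯.σB p α F • (𝒯.intB F).compl₁₂ (jumpB F) (jumpB F)

variable {𝒯}

/-- The total lifting `v ↦ ℛ(⟦v⟧) + ℒ(β · ⟦v⟧)`. -/
def lift (M : DGMethod 𝒯) : 𝒯.V p →ₗ[ℝ] 𝒯.VV p :=
  (∑ F, liftR F + ∑ F, liftRB F) + ∑ F, liftL (M.β F) F

/-- The discontinuous Galerkin bilinear form on `V`; `form_apply` is its explicit formula. -/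
def form (M : DGMethod 𝒯) : LinearMap.BilinForm ℝ (𝒯.V p) :=
  ∑ T, (𝒯.intElt T).compl₁₂ (grad T) (grad T)
    + ∑ T, (𝒯.intElt T).compl₁₂ (grad T) (vec T ∘ₗ lift p M)
    + ∑ T, (𝒯.intElt T).compl₁₂ (vec T ∘ₗ lift p M) (grad T)
    + 𝒯.stab p α
    + M.θ • (l2 𝒯 p).compl₁₂ (lift p M) (lift p M)

lemma form_apply (M : DGMethod 𝒯) (w v : 𝒯.V p) :
    form p α M w v =
      (∑ T, ∫ x in 𝒯.elt T, inner ℝ (gradient (w.1 T) x) (gradient (v.1 T) x))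
      + (∑ T, ∫ x in 𝒯.elt T, inner ℝ (gradient (w.1 T) x) (vec T (lift p M v) x))
      + (∑ T, ∫ x in 𝒯.elt T, inner ℝ (vec T (lift p M w) x) (gradient (v.1 T) x))
      + ((∑ F, ∫ x in 𝒯.iface F, 𝒯.σI p α F * inner ℝ (jumpI F w x) (jumpI F v x) ∂(surf d))
        + ∑ F, ∫ x in 𝒯.bface F, 𝒯.σB p α F * inner ℝ (jumpB F w x) (jumpB F v x) ∂(surf d))
      + M.θ * ∑ T, ∫ x in 𝒯.elt T, inner ℝ (vec T (lift p M w) x) (vec T (lift p M v) x) := by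
  simp [form, stab, l2_apply, LinearMap.sum_apply, intElt, intI, intB, intPair_apply, grad,
    integral_const_mul]

end Mesh

/-- `𝒯'` is a refinement of `𝒯`: each element of `𝒯'` lies in an element of `𝒯`, and for
parallelepipeds its edges are parallel to those of that element, as is the case for repeated
uniform subdivision. -/
def Mesh.Refines {s : Shape} {d : ℕ} {Ω : Set (E d)} (𝒯 𝒯' : Mesh s d Ω) : Prop :=
  ∀ T', ∃ T, 𝒯'.elt T' ⊆ 𝒯.elt T ∧
    (s = .cube → ∃ (π : Equiv.Perm (Fin d)) (a b : Fin d → ℝ),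
        ∀ (x : E d) (i : Fin d), (𝒯.F T).symm (𝒯'.F T' x) i = a i + b i * x (π i))

lemma comp_mem_poly_simplex {d p : ℕ} {f : E d → ℝ} (hf : f ∈ Shape.simplex.poly d p)
    (A : E d →ᵃ[ℝ] E d) : f ∘ A ∈ Shape.simplex.poly d p := by
  obtain ⟨q, hq, rfl⟩ := hf
  let r : Fin d → MvPolynomial (Fin d) ℝ := fun i =>
    MvPolynomial.C (A 0 i) + ∑ j, MvPolynomial.C (A.linear (EuclideanSpace.single j 1) i) *
      MvPolynomial.X j
  have hr : ∀ i, (r i).totalDegree ≤ 1 := fun i => by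
    refine (MvPolynomial.totalDegree_add _ _).trans (max_le (by simp) ?_)
    refine MvPolynomial.totalDegree_finsetSum_le fun j _ => ?_
    refine (MvPolynomial.totalDegree_mul _ _).trans ?_
    simp
  have hev : ∀ (x : E d) i, MvPolynomial.eval (fun j => x j) (r i) = A x i := fun x i => by
    have h1 : A x = A.linear x + A 0 := by
      have := A.linearMap_vsub x 0
      simp only [vsub_eq_sub, sub_zero] at this
      rw [this]; abel
    have h2 : A.linear x = ∑ j, x j • A.linear (EuclideanSpace.single j 1) := by
      conv_lhs => rw [← (EuclideanSpace.basisFun (Fin d) ℝ).sum_repr x]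
      simp [map_sum]
    rw [h1, h2]
    simp [r, mul_comm, add_comm]
  refine ⟨MvPolynomial.bind₁ r q, ?_, ?_⟩
  · rw [SetLike.mem_coe, MvPolynomial.mem_restrictTotalDegree] at *
    rw [MvPolynomial.bind₁, MvPolynomial.aeval_def, MvPolynomial.eval₂_eq]
    refine MvPolynomial.totalDegree_finsetSum_le fun m hm => ?_
    refine (MvPolynomial.totalDegree_mul _ _).trans ?_
    have h1 : (algebraMap ℝ (MvPolynomial (Fin d) ℝ) (q.coeff m)).totalDegree = 0 := by
      simp [MvPolynomial.algebraMap_eq]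
    rw [h1, zero_add]
    refine (MvPolynomial.totalDegree_finsetProd _ _).trans ?_
    calc ∑ i ∈ m.support, (r i ^ m i).totalDegree ≤ ∑ i ∈ m.support, m i :=
          Finset.sum_le_sum fun i _ => (MvPolynomial.totalDegree_pow _ _).trans
            ((Nat.mul_le_mul_left _ (hr i)).trans (by simp))
      _ ≤ p := (MvPolynomial.le_totalDegree hm).trans hq
  · ext x
    simp only [evalFun, LinearMap.coe_mk, AddHom.coe_mk, Function.comp_apply]
    rw [← MvPolynomial.aeval_eq_eval, MvPolynomial.aeval_bind₁]
    simp only [MvPolynomial.aeval_eq_eval, hev]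

lemma comp_mem_poly_cube {d p : ℕ} {f : E d → ℝ} (hf : f ∈ Shape.cube.poly d p)
    (A : E d → E d) (π : Equiv.Perm (Fin d)) (a b : Fin d → ℝ)
    (hA : ∀ x i, A x i = a i + b i * x (π i)) : f ∘ A ∈ Shape.cube.poly d p := by
  obtain ⟨q, hq, rfl⟩ := hf
  let r : Fin d → MvPolynomial (Fin d) ℝ := fun i =>
    MvPolynomial.C (a i) + MvPolynomial.C (b i) * MvPolynomial.X (π i)
  have hr : ∀ i j, (r i).degreeOf j ≤ if π i = j then 1 else 0 := fun i j => by
    refine (MvPolynomial.degreeOf_add_le _ _ _).trans (max_le (by simp) ?_)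
    refine (MvPolynomial.degreeOf_C_mul_le _ _ _).trans ?_
    rw [MvPolynomial.degreeOf_X]
    simp [eq_comm]
  refine ⟨MvPolynomial.bind₁ r q, ?_, ?_⟩
  · rw [SetLike.mem_coe, MvPolynomial.mem_restrictDegree] at *
    suffices h : ∀ j, (MvPolynomial.bind₁ r q).degreeOf j ≤ p from fun m hm j =>
      (MvPolynomial.degreeOf_le_iff.1 (h j)) m hm
    intro j
    rw [MvPolynomial.bind₁, MvPolynomial.aeval_def, MvPolynomial.eval₂_eq]
    refine (MvPolynomial.degreeOf_sum_le _ _ _).trans (Finset.sup_le fun m hm => ?_)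
    rw [MvPolynomial.algebraMap_eq]
    refine (MvPolynomial.degreeOf_C_mul_le _ _ _).trans ?_
    refine (MvPolynomial.degreeOf_prod_le _ _ _).trans ?_
    calc ∑ i ∈ m.support, (r i ^ m i).degreeOf j
        ≤ ∑ i ∈ m.support, if π i = j then m i else 0 :=
          Finset.sum_le_sum fun i _ => (MvPolynomial.degreeOf_pow_le _ _ _).trans
            ((Nat.mul_le_mul_left _ (hr i j)).trans (by split_ifs <;> simp))
      _ ≤ ∑ i, if i = π.symm j then m i else 0 := by
          refine (Finset.sum_le_univ_sum_of_nonneg fun i => Nat.zero_le _).trans_eq ?_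
          exact Finset.sum_congr rfl fun i _ => by simp [Equiv.eq_symm_apply]
      _ ≤ p := by simpa using hq m hm _
  · ext x
    simp only [evalFun, LinearMap.coe_mk, AddHom.coe_mk, Function.comp_apply]
    rw [← MvPolynomial.aeval_eq_eval, MvPolynomial.aeval_bind₁]
    simp only [MvPolynomial.aeval_eq_eval, hA]
    simp [r]

namespace Mesh

variable {s : Shape} {d : ℕ} {Ω : Set (E d)} {𝒯 𝒯' : Mesh s d Ω}

/-- The element of the coarse mesh that contains `T'`. -/
def Refines.parent (h : 𝒯.Refines 𝒯') (T' : Fin 𝒯'.N) : Fin 𝒯.N := (h T').choose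

/-- The prolongation: the natural injection of the coarse space into the fine space. -/
def Refines.prolong (h : 𝒯.Refines 𝒯') {p p' : ℕ} (hp : p ≤ p') : 𝒯.V p →ₗ[ℝ] 𝒯'.V p' where
  toFun v := ⟨fun T' => v.1 (h.parent T'), fun T' => by
    have hv := v.2 (h.parent T')
    have hT := (h T').choose_spec.2
    have hcomp : v.1 (h.parent T') ∘ 𝒯'.F T' =
        (v.1 (h.parent T') ∘ 𝒯.F (h.parent T')) ∘
          ((𝒯.F (h.parent T')).symm ∘ 𝒯'.F T') := by
      ext x; simp
    rw [hcomp]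
    refine s.poly_mono d hp ?_
    cases s
    · exact comp_mem_poly_simplex hv
        ((𝒯.F (h.parent T')).symm.toAffineMap.comp (𝒯'.F T').toAffineMap)
    · obtain ⟨π, a, b, hab⟩ := hT rfl
      exact comp_mem_poly_cube hv _ π a b hab⟩
  map_add' _ _ := rfl
  map_smul' _ _ := rfl

variable (𝒯) in
/-- The basis of `V` that comes from a basis `b` of the local space on the reference element: each
basis function is supported on one element `T`, where it is `b i ∘ F_T⁻¹`. -/
def basis {p r : ℕ} (b : Module.Basis (Fin r) ℝ (s.poly d p)) :
    Module.Basis (Σ _ : Fin 𝒯.N, Fin r) ℝ (𝒯.V p) :=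
  (Pi.basis fun _ => b).map (𝒯.pullback p).symm

variable (𝒯) in
/-- The mesh-dependent inner product `(u, v) = hᵈ ∑ᵢ uᵢ vᵢ`, through the coefficients in the basis. -/
def ip {p r : ℕ} (b : Module.Basis (Fin r) ℝ (s.poly d p)) : LinearMap.BilinForm ℝ (𝒯.V p) :=
  𝒯.size ^ d • ∑ i, LinearMap.BilinForm.linMulLin ((𝒯.basis b).coord i) ((𝒯.basis b).coord i)

lemma ip_apply {p r : ℕ} (b : Module.Basis (Fin r) ℝ (s.poly d p)) (u v : 𝒯.V p) :
    𝒯.ip b u v = 𝒯.size ^ d * ∑ i, (𝒯.basis b).repr u i * (𝒯.basis b).repr v i := by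
  simp [ip, LinearMap.sum_apply]

lemma diam_pos [NeZero d] (T : Fin 𝒯.N) : 0 < 𝒯.diam T := by
  have : Nonempty (Fin d) := ⟨0⟩
  obtain ⟨x, hx⟩ := 𝒯.elt_nonempty T
  exact Metric.diam_pos
    (infinite_of_mem_nhds x (IsOpen.mem_nhds (𝒯.elt_isOpen T) hx)).nontrivial
    (𝒯.elt_isBounded T)

lemma size_pos [NeZero d] (T : Fin 𝒯.N) : 0 < 𝒯.size :=
  (diam_pos T).trans_le (le_ciSup (f := 𝒯.diam) (Set.finite_range _).bddAbove T)

lemma ip_nondegenerate [NeZero d] {p r : ℕ} (b : Module.Basis (Fin r) ℝ (s.poly d p)) :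
    (𝒯.ip b).Nondegenerate := by
  have hsymm : ∀ u v, 𝒯.ip b u v = 𝒯.ip b v u := fun u v => by
    simp only [ip_apply, mul_comm]
  have hdef : ∀ u, 𝒯.ip b u u = 0 → u = 0 := by
    intro u h
    apply (𝒯.basis b).repr.injective
    ext i
    rw [ip_apply, mul_eq_zero, or_iff_right (pow_pos (size_pos i.1) d).ne',
      Finset.sum_eq_zero_iff_of_nonneg fun i _ => mul_self_nonneg _] at h
    simpa using h i (Finset.mem_univ i)
  exact ⟨fun u h => hdef u (h u), fun u h => hdef u (h u)⟩

/-- The norm `√((Aᵗ v, v))`, where the real power `Aᵗ` is taken by the functional calculus of the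
matrix of `A` in the basis, which is symmetric when `A` is self-adjoint for the inner product. -/
def powNorm {p r : ℕ} (b : Module.Basis (Fin r) ℝ (s.poly d p)) (A : 𝒯.V p →ₗ[ℝ] 𝒯.V p) (t : ℝ)
    (v : 𝒯.V p) : ℝ :=
  √(𝒯.ip b (Matrix.toLin (𝒯.basis b) (𝒯.basis b)
    (cfc (fun x : ℝ => x ^ t) (LinearMap.toMatrix (𝒯.basis b) (𝒯.basis b) A)) v) v)

end Mesh

/-- A nested sequence of `n + 1` meshes of `Ω`, from the coarsest (index `0`) to the finest (index
`n`), with polynomial degrees that do not decrease. -/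
structure Hierarchy (s : Shape) (d : ℕ) (Ω : Set (E d)) (n : ℕ) where
  mesh : Fin (n + 1) → Mesh s d Ω
  refines : ∀ k l, k ≤ l → (mesh k).Refines (mesh l)
  deg : Fin (n + 1) → ℕ
  one_le_deg : ∀ k, 1 ≤ deg k
  deg_mono : Monotone deg

namespace Hierarchy

variable {s : Shape} {d n : ℕ} {Ω : Set (E d)} (H : Hierarchy s d Ω n)

/-- The space `V_k`. -/
abbrev V (k : Fin (n + 1)) : Submodule ℝ (Fin (H.mesh k).N → E d → ℝ) := (H.mesh k).V (H.deg k)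

/-- The prolongation from level `k` to the finest level. It is the product of the prolongations
between successive levels, each of which is a natural injection. -/
def R (k : Fin (n + 1)) : H.V k →ₗ[ℝ] H.V (Fin.last n) :=
  (H.refines k (Fin.last n) (Fin.le_last k)).prolong (H.deg_mono (Fin.le_last k))

variable (M : DGMethod (H.mesh (Fin.last n))) (α : ℝ) (k : Fin (n + 1))

/-- The inherited bilinear form `(v, w) ↦ 𝒜_K(R v, R w)` on `V_k`, where `𝒜_K` is the form of the
method on the finest level. -/
def formR : LinearMap.BilinForm ℝ (H.V k) :=
  (Mesh.form (H.deg (Fin.last n)) α M).compl₁₂ (H.R k) (H.R k)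

/-- The operator of the inherited form: `(A u, v)_k = 𝒜ᴿ_k(u, v)` for all `u, v ∈ V_k`. -/
def A [NeZero d] {r : ℕ} (b : Module.Basis (Fin r) ℝ (s.poly d (H.deg k))) :
    H.V k →ₗ[ℝ] H.V k :=
  LinearMap.BilinForm.symmCompOfNondegenerate (H.formR M α k) ((H.mesh k).ip b)
    (Mesh.ip_nondegenerate b)


lemma ip_A [NeZero d] {r : ℕ} (b : Module.Basis (Fin r) ℝ (s.poly d (H.deg k))) (u v : H.V k) :
    (H.mesh k).ip b (H.A M α k b u) v = H.formR M α k u v :=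
  LinearMap.BilinForm.symmCompOfNondegenerate_left_apply _ _ v u

/-- The error propagation operator of the Richardson smoother scaled by `Λ`: `G = I - Λ⁻¹ A`. -/
def G [NeZero d] {r : ℕ} (b : Module.Basis (Fin r) ℝ (s.poly d (H.deg k))) (Λ : ℝ) :
    Module.End ℝ (H.V k) :=
  1 - Λ⁻¹ • H.A M α k b

end Hierarchy

end

end HpDG

/-!
# Smoothing property of the Richardson iteration for inherited hp-DG forms

In the basis that defines the inner product `(·,·)_k` the operator `A` of the inherited form has a
matrix `N`. It is symmetric because the form is (`form_symm`), and positive semidefinite because the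
form is nonnegative (`form_nonneg`): for SIPG and SIPG(δ) this is the assumption on `α`, while for
LDG (`θ = 1`) the form is `∑_T ∫_T |∇w + ℓ(w)|² dx` plus the penalty term. So the spectrum of `N`
lies in `[0, Λ]`, and `|||Gᵐ v|||_s²` and `|||v|||_t²` are `hᵈ` times the quadratic forms of
`(1 - N/Λ)²ᵐ Nˢ` and `Nᵗ` at the coefficient vector of `v`.

By monotonicity of the functional calculus the comparison of these forms (`posSemidef_smoothing`)
reduces to the scalar inequality
`(1 - μ/Λ)²ᵐ μˢ ≤ Λ^(s-t) (1+m)^(t-s) μᵗ` for `0 ≤ μ ≤ Λ`. With `x = μ/Λ` and `a = s - t ∈ [0, 2]`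
it says `xᵃ (1-x)²ᵐ ≤ (1+m)^(-a)`, which follows from `(1-x)²ᵐ ≤ (1-x)^(ma)` and the Bernoulli
bound `x (1-x)ᵐ ≤ 1/(1+m)`. The assumed bound on `Λ` turns `Λ^((s-t)/2)` into the stated powers of
degrees and mesh sizes, with constant `C₀^((s-t)/2) ≤ max 1 C₀`.
-/

namespace HpDG

/-! ### The scalar inequality -/

/-- Bernoulli's inequality gives `(1 - x)ᵐ (1 + m x) ≤ (1 - x²)ᵐ ≤ 1`. -/
lemma mul_one_sub_pow_le {x : ℝ} (hx0 : 0 ≤ x) (hx1 : x ≤ 1) (m : ℕ) :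
    x * (1 - x) ^ m ≤ (1 + (m : ℝ))⁻¹ := by
  have hm : (0 : ℝ) ≤ m := m.cast_nonneg
  have h1 : 1 + m * x ≤ (1 + x) ^ m := one_add_mul_le_pow (by linarith) m
  have h2 : (1 - x) ^ m * (1 + x) ^ m ≤ 1 := by
    rw [← mul_pow]
    exact pow_le_one₀ (by nlinarith) (by nlinarith)
  have h0 : 0 ≤ (1 - x) ^ m := pow_nonneg (by linarith) m
  rw [← one_div, le_div_iff₀ (by positivity)]
  calc x * (1 - x) ^ m * (1 + m) = (1 - x) ^ m * (x + m * x) := by ring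
    _ ≤ (1 - x) ^ m * (1 + x) ^ m := by gcongr; linarith
    _ ≤ 1 := h2

lemma rpow_mul_one_sub_pow_sq_le {x a : ℝ} (hx0 : 0 ≤ x) (hx1 : x ≤ 1) (ha0 : 0 ≤ a)
    (ha2 : a ≤ 2) (m : ℕ) :
    x ^ a * ((1 - x) ^ m) ^ 2 ≤ (1 + (m : ℝ)) ^ (-a) := by
  have h0 : 0 ≤ (1 - x) ^ m := pow_nonneg (by linarith) m
  have h1 : (1 - x) ^ m ≤ 1 := pow_le_one₀ (by linarith) (by linarith)
  calc x ^ a * ((1 - x) ^ m) ^ 2 = x ^ a * ((1 - x) ^ m) ^ (2 : ℝ) := by norm_cast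
    _ ≤ x ^ a * ((1 - x) ^ m) ^ a := by
        gcongr ?_ * ?_
        exact Real.rpow_le_rpow_of_exponent_ge_of_imp h0 h1 ha2 fun _ h => by linarith
    _ = (x * (1 - x) ^ m) ^ a := (Real.mul_rpow hx0 h0).symm
    _ ≤ ((1 + (m : ℝ))⁻¹) ^ a :=
        Real.rpow_le_rpow (mul_nonneg hx0 h0) (mul_one_sub_pow_le hx0 hx1 m) ha0
    _ = (1 + (m : ℝ)) ^ (-a) := by rw [Real.inv_rpow (by positivity), Real.rpow_neg (by positivity)]

lemma one_sub_div_pow_sq_mul_rpow_le {μ Λ s t : ℝ} (hΛ : 0 < Λ) (hμ0 : 0 ≤ μ) (hμΛ : μ ≤ Λ)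
    (ht : 0 ≤ t) (hts : t ≤ s) (hs : s ≤ 2) (m : ℕ) :
    ((1 - Λ⁻¹ * μ) ^ m) ^ 2 * μ ^ s ≤ Λ ^ (s - t) * (1 + (m : ℝ)) ^ (t - s) * μ ^ t := by
  have hx0 : 0 ≤ Λ⁻¹ * μ := by positivity
  have hx1 : Λ⁻¹ * μ ≤ 1 := by rw [inv_mul_le_iff₀ hΛ]; linarith
  have hst : 0 ≤ s - t := by linarith
  have key := rpow_mul_one_sub_pow_sq_le hx0 hx1 hst (by linarith) m
  have h1 : μ ^ s = Λ ^ (s - t) * (Λ⁻¹ * μ) ^ (s - t) * μ ^ t := by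
    rw [← Real.mul_rpow hΛ.le hx0, mul_inv_cancel_left₀ hΛ.ne', ← Real.rpow_add_of_nonneg hμ0 hst ht,
      sub_add_cancel]
  calc ((1 - Λ⁻¹ * μ) ^ m) ^ 2 * μ ^ s
      = Λ ^ (s - t) * ((Λ⁻¹ * μ) ^ (s - t) * ((1 - Λ⁻¹ * μ) ^ m) ^ 2) * μ ^ t := by rw [h1]; ring
    _ ≤ Λ ^ (s - t) * (1 + (m : ℝ)) ^ (-(s - t)) * μ ^ t := by gcongr
    _ = _ := by rw [neg_sub]

/-! ### Symmetric positive semidefinite matrices -/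

open Matrix in
open scoped MatrixOrder in
/-- The smoothing property for a positive semidefinite matrix `N` with spectrum in `[0, Λ]`, in terms
of the quadratic forms of the powers of `N`. -/
lemma posSemidef_smoothing {ι : Type*} [Fintype ι] [DecidableEq ι] {N : Matrix ι ι ℝ}
    (hN : N.PosSemidef) {Λ : ℝ} (hΛ : 0 < Λ) (hspec : ∀ μ ∈ spectrum ℝ N, μ ≤ Λ)
    {s t : ℝ} (ht : 0 ≤ t) (hts : t ≤ s) (hs : s ≤ 2) (m : ℕ) (x : ι → ℝ) :
    (((1 - Λ⁻¹ • N) ^ m) *ᵥ x) ⬝ᵥ (cfc (fun y : ℝ => y ^ s) N *ᵥ (((1 - Λ⁻¹ • N) ^ m) *ᵥ x)) ≤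
      Λ ^ (s - t) * (1 + (m : ℝ)) ^ (t - s) * (x ⬝ᵥ (cfc (fun y : ℝ => y ^ t) N *ᵥ x)) := by
  have hsa : IsSelfAdjoint N := hN.isHermitian
  have hcs : ContinuousOn (fun y : ℝ => y ^ s) (spectrum ℝ N) :=
    (Real.continuous_rpow_const (ht.trans hts)).continuousOn
  have hct : ContinuousOn (fun y : ℝ => y ^ t) (spectrum ℝ N) :=
    (Real.continuous_rpow_const ht).continuousOn
  have hg : (1 - Λ⁻¹ • N) ^ m = cfc (fun y : ℝ => (1 - Λ⁻¹ * y) ^ m) N := by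
    rw [cfc_pow (fun y : ℝ => 1 - Λ⁻¹ * y) m N, cfc_sub (fun _ : ℝ => (1 : ℝ)) (fun y => Λ⁻¹ * y) N,
      cfc_const_one ℝ N, cfc_const_mul_id Λ⁻¹ N]
  have hgT : (cfc (fun y : ℝ => (1 - Λ⁻¹ * y) ^ m) N)ᵀ =
      cfc (fun y : ℝ => (1 - Λ⁻¹ * y) ^ m) N := by
    have h : IsSelfAdjoint (cfc (fun y : ℝ => (1 - Λ⁻¹ * y) ^ m) N) := cfc_predicate _ _
    rw [← conjTranspose_eq_transpose_of_trivial]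
    exact h
  have hle : cfc (fun y : ℝ => (1 - Λ⁻¹ * y) ^ m * (y ^ s * (1 - Λ⁻¹ * y) ^ m)) N ≤
      cfc (fun y : ℝ => Λ ^ (s - t) * (1 + (m : ℝ)) ^ (t - s) * y ^ t) N := by
    refine cfc_mono (fun y hy => ?_) (by fun_prop) (by fun_prop)
    have hy0 : 0 ≤ y := (posSemidef_iff_isHermitian_and_spectrum_nonneg.1 hN).2 hy
    have := one_sub_div_pow_sq_mul_rpow_le hΛ hy0 (hspec y hy) ht hts hs m
    linarith
  rw [cfc_mul _ _ N (by fun_prop) (by fun_prop), cfc_mul _ _ N hcs (by fun_prop),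
    cfc_const_mul _ _ N hct, Matrix.le_iff] at hle
  have := hle.dotProduct_mulVec_nonneg x
  rw [sub_mulVec, dotProduct_sub, smul_mulVec, dotProduct_smul, star_trivial, sub_nonneg,
    smul_eq_mul] at this
  refine le_of_eq_of_le ?_ this
  rw [hg, ← mulVec_mulVec, ← mulVec_mulVec, dotProduct_mulVec x, ← mulVec_transpose, hgT]

/-! ### The discontinuous Galerkin form -/

namespace Mesh

variable {s : Shape} {d : ℕ} {Ω : Set (E d)} {𝒯 : Mesh s d Ω}

lemma form_symm (p : ℕ) (α : ℝ) (M : DGMethod 𝒯) (w v : 𝒯.V p) :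
    form p α M w v = form p α M v w := by
  simp only [form_apply, real_inner_comm]
  ring

/-- The form is nonnegative for every method as soon as it is so for the methods with `θ = 0`. For
`θ = 1` it is `∑_T ∫_T |∇w + ℓ(w)|² dx` plus the penalty term. -/
lemma form_nonneg (p : ℕ) {α : ℝ} (hα : 0 ≤ α) (M : DGMethod 𝒯)
    (hM : M.θ = 0 → ∀ w : 𝒯.V p, 0 ≤ form p α M w w) (w : 𝒯.V p) : 0 ≤ form p α M w w := by
  by_cases h0 : M.θ = 0
  · exact hM h0 w
  have h1 : M.θ = 1 := by cases M <;> simp_all [DGMethod.θ]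
  have hsq : ∀ T, 0 ≤ 𝒯.intElt T (grad T w + vec T (lift p M w)) (grad T w + vec T (lift p M w)) :=
    fun T => integral_nonneg fun x => real_inner_self_nonneg
  have hstab : 0 ≤ 𝒯.stab p α w w := by
    have hI : ∀ F, 0 ≤ 𝒯.σI p α F := fun F =>
      div_nonneg (by positivity) (le_min Metric.diam_nonneg Metric.diam_nonneg)
    have hB : ∀ F, 0 ≤ 𝒯.σB p α F := fun F => div_nonneg (by positivity) Metric.diam_nonneg
    simp only [stab, LinearMap.add_apply, LinearMap.sum_apply, LinearMap.smul_apply]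
    exact add_nonneg
      (Finset.sum_nonneg fun F _ => mul_nonneg (hI F) (integral_nonneg fun x =>
        real_inner_self_nonneg))
      (Finset.sum_nonneg fun F _ => mul_nonneg (hB F) (integral_nonneg fun x =>
        real_inner_self_nonneg))
  have : form p α M w w = ∑ T, 𝒯.intElt T (grad T w + vec T (lift p M w))
      (grad T w + vec T (lift p M w)) + 𝒯.stab p α w w := by
    simp only [form, l2, h1, one_smul, LinearMap.add_apply, LinearMap.sum_apply,
      LinearMap.compl₁₂_apply, LinearMap.comp_apply, map_add, Finset.sum_add_distrib]
    ring
  rw [this]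
  exact add_nonneg (Finset.sum_nonneg fun T _ => hsq T) hstab

/-! ### Coordinates with respect to the basis of the inner product -/

open Matrix in
lemma ip_eq_dotProduct {p r : ℕ} (b : Module.Basis (Fin r) ℝ (s.poly d p)) (u v : 𝒯.V p) :
    𝒯.ip b u v = 𝒯.size ^ d * ((𝒯.basis b).repr u ⬝ᵥ (𝒯.basis b).repr v) :=
  ip_apply b u v

open Matrix in
lemma powNorm_eq {p r : ℕ} (b : Module.Basis (Fin r) ℝ (s.poly d p)) (A : 𝒯.V p →ₗ[ℝ] 𝒯.V p)
    (t : ℝ) (v : 𝒯.V p) :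
    powNorm b A t v = √(𝒯.size ^ d * ((𝒯.basis b).repr v ⬝ᵥ
      (cfc (fun x : ℝ => x ^ t) (LinearMap.toMatrix (𝒯.basis b) (𝒯.basis b) A) *ᵥ
        (𝒯.basis b).repr v))) := by
  rw [powNorm, ip_eq_dotProduct, Matrix.repr_toLin, dotProduct_comm]

open Matrix in
lemma toMatrix_posSemidef [NeZero d] [Nonempty (Fin 𝒯.N)] {p r : ℕ}
    (b : Module.Basis (Fin r) ℝ (s.poly d p)) {A : 𝒯.V p →ₗ[ℝ] 𝒯.V p}
    (hsymm : ∀ u v, 𝒯.ip b (A u) v = 𝒯.ip b (A v) u) (hpos : ∀ u, 0 ≤ 𝒯.ip b (A u) u) :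
    (LinearMap.toMatrix (𝒯.basis b) (𝒯.basis b) A).PosSemidef := by
  have hsz : 0 < 𝒯.size ^ d := pow_pos (size_pos (Classical.arbitrary (Fin 𝒯.N))) d
  refine .of_dotProduct_mulVec_nonneg (IsHermitian.ext fun i j => ?_) fun x => ?_
  · have := hsymm ((𝒯.basis b) i) ((𝒯.basis b) j)
    simp only [ip_eq_dotProduct, Module.Basis.repr_self, Finsupp.single_eq_pi_single,
      dotProduct_single_one] at this
    rw [star_trivial, LinearMap.toMatrix_apply, LinearMap.toMatrix_apply]
    exact mul_left_cancel₀ hsz.ne' this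
  · have := hpos ((𝒯.basis b).equivFun.symm x)
    rw [ip_eq_dotProduct, ← LinearMap.toMatrix_mulVec_repr (𝒯.basis b) (𝒯.basis b)] at this
    have hx : ⇑((𝒯.basis b).repr ((𝒯.basis b).equivFun.symm x)) = x :=
      (𝒯.basis b).equivFun.apply_symm_apply x
    rw [hx, dotProduct_comm] at this
    exact nonneg_of_mul_nonneg_right this hsz

lemma nonempty_elements (h : Ω.Nonempty) : Nonempty (Fin 𝒯.N) := by
  by_contra hN
  rw [not_nonempty_iff] at hN
  have := 𝒯.cover
  rw [iUnion_of_empty] at this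
  exact h.closure.ne_empty this.symm

/-- The smoothing property of `1 - Λ⁻¹ A` for an operator `A` that is self-adjoint and nonnegative
for the mesh-dependent inner product, with eigenvalues bounded by `Λ`. -/
theorem powNorm_one_sub_pow_le [NeZero d] [Nonempty (Fin 𝒯.N)] {p r : ℕ}
    (b : Module.Basis (Fin r) ℝ (s.poly d p)) {A : 𝒯.V p →ₗ[ℝ] 𝒯.V p}
    (hsymm : ∀ u v, 𝒯.ip b (A u) v = 𝒯.ip b (A v) u) (hpos : ∀ u, 0 ≤ 𝒯.ip b (A u) u)
    {Λ : ℝ} (hΛ : 0 < Λ) (hA : ∀ μ : ℝ, Module.End.HasEigenvalue A μ → |μ| ≤ Λ)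
    {σ τ : ℝ} (hτ : 0 ≤ τ) (hτσ : τ ≤ σ) (hσ : σ ≤ 2) (m : ℕ) (v : 𝒯.V p) :
    powNorm b A σ (((1 - Λ⁻¹ • A : Module.End ℝ (𝒯.V p)) ^ m) v) ≤
      √(Λ ^ (σ - τ) * (1 + (m : ℝ)) ^ (τ - σ)) * powNorm b A τ v := by
  have hspec : ∀ μ ∈ spectrum ℝ (LinearMap.toMatrix (𝒯.basis b) (𝒯.basis b) A), μ ≤ Λ := by
    intro μ hμ
    rw [← Matrix.spectrum_toLin _ (𝒯.basis b), Matrix.toLin_toMatrix] at hμ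
    exact (le_abs_self μ).trans (hA μ (Module.End.hasEigenvalue_iff_mem_spectrum.2 hμ))
  have hpow : LinearMap.toMatrix (𝒯.basis b) (𝒯.basis b)
      ((1 - Λ⁻¹ • A : Module.End ℝ (𝒯.V p)) ^ m) =
      (1 - Λ⁻¹ • LinearMap.toMatrix (𝒯.basis b) (𝒯.basis b) A) ^ m := by
    rw [← LinearMap.toMatrix_pow]
    congr 1
    refine (map_sub (LinearMap.toMatrix (𝒯.basis b) (𝒯.basis b)) 1 (Λ⁻¹ • A)).trans ?_
    rw [map_smul, LinearMap.toMatrix_one]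
  rw [powNorm_eq, powNorm_eq, ← Real.sqrt_mul (by positivity),
    ← LinearMap.toMatrix_mulVec_repr (𝒯.basis b) (𝒯.basis b), hpow]
  refine Real.sqrt_le_sqrt ?_
  rw [mul_left_comm]
  gcongr
  · exact pow_nonneg (size_pos (Classical.arbitrary (Fin 𝒯.N))).le d
  · exact posSemidef_smoothing (toMatrix_posSemidef b hsymm hpos) hΛ hspec hτ hτσ hσ m _

end Mesh

/-! ### The constant -/

/-- Half powers of a number `Λ ≤ C₀ P² / Q`. The exponent `a` is at most `2`, so `C₀` enters at most
to the first power, and the maximum with `1` makes the constant independent of `a`. -/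
lemma sqrt_rpow_mul_rpow_le {C₀ Λ P Q a M : ℝ} (hC₀ : 0 ≤ C₀) (hΛ : 0 ≤ Λ) (hP : 0 ≤ P)
    (hQ : 0 < Q) (hM : 0 ≤ M) (ha0 : 0 ≤ a) (ha2 : a ≤ 2) (h : Λ ≤ C₀ * (P ^ 2 / Q)) :
    √(Λ ^ a * M ^ (-a)) ≤ max 1 C₀ * P ^ a * Q ^ (-a / 2) * M ^ (-a / 2) := by
  have hmax : C₀ ^ (a / 2) ≤ max 1 C₀ := by
    calc C₀ ^ (a / 2) ≤ (max 1 C₀) ^ (a / 2) :=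
          Real.rpow_le_rpow hC₀ (le_max_right _ _) (by linarith)
      _ ≤ (max 1 C₀) ^ (1 : ℝ) :=
          Real.rpow_le_rpow_of_exponent_le (le_max_left _ _) (by linarith)
      _ = max 1 C₀ := Real.rpow_one _
  rw [Real.sqrt_eq_rpow, Real.mul_rpow (by positivity) (by positivity), ← Real.rpow_mul hΛ,
    ← Real.rpow_mul hM, mul_one_div, mul_one_div]
  gcongr
  calc Λ ^ (a / 2) ≤ (C₀ * (P ^ 2 / Q)) ^ (a / 2) := Real.rpow_le_rpow hΛ h (by linarith)
    _ = C₀ ^ (a / 2) * P ^ a * Q ^ (-a / 2) := by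
        have hPa : (P ^ 2) ^ (a / 2) = P ^ a := by
          rw [← Real.rpow_natCast, ← Real.rpow_mul hP]
          congr 1
          push_cast
          ring
        rw [Real.mul_rpow hC₀ (by positivity), Real.div_rpow (by positivity) hQ.le, hPa, neg_div,
          Real.rpow_neg hQ.le, mul_assoc, ← div_eq_mul_inv]
    _ ≤ max 1 C₀ * P ^ a * Q ^ (-a / 2) := by gcongr

end HpDG

theorem lemma6p1 (C₀ : ℝ) (hC₀ : 0 < C₀) :
    ∃ C : ℝ, 0 < C ∧
      ∀ (d : ℕ) [NeZero d] (_ : d = 2 ∨ d = 3)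
        (Ω : Set (HpDG.E d)) (_ : IsOpen Ω) (_ : IsConnected Ω) (_ : interior (closure Ω) = Ω)
        (S : HpDG.Shape) (n : ℕ) (H : HpDG.Hierarchy S d Ω n)
        (M : HpDG.DGMethod (H.mesh (Fin.last n))) (α : ℝ) (_ : 0 < α)
        (_ : M.θ = 0 → ∀ w : H.V (Fin.last n),
          0 ≤ HpDG.Mesh.form (H.deg (Fin.last n)) α M w w)
        (k : Fin (n + 1)) (r : ℕ) (b : Module.Basis (Fin r) ℝ (S.poly d (H.deg k)))
        (_ : ∀ i j, ∫ x in S.ref d, (b i : HpDG.E d → ℝ) x * (b j : HpDG.E d → ℝ) x =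
          if i = j then 1 else 0)
        (Λ : ℝ) (_ : 0 < Λ)
        (_ : ∀ μ : ℝ, Module.End.HasEigenvalue (H.A M α k b) μ → |μ| ≤ Λ)
        (_ : Λ ≤ C₀ * ((H.deg (Fin.last n) : ℝ) ^ 2 * (H.deg k : ℝ) ^ 2 /
          ((H.mesh (Fin.last n)).size * (H.mesh k).size)))
        (m : ℕ) (s t : ℝ) (_ : 0 ≤ t) (_ : t ≤ s) (_ : s ≤ 2) (v : H.V k),
        HpDG.Mesh.powNorm b (H.A M α k b) s ((H.G M α k b Λ ^ m) v) ≤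
          C * ((H.deg (Fin.last n) : ℝ) * H.deg k) ^ (s - t) *
            ((H.mesh (Fin.last n)).size * (H.mesh k).size) ^ ((t - s) / 2) *
            (1 + (m : ℝ)) ^ ((t - s) / 2) *
            HpDG.Mesh.powNorm b (H.A M α k b) t v := by

  refine ⟨max 1 C₀, by positivity, ?_⟩
  intro d _ _ Ω _ hΩ _ S n H M α hα hM k r b _ Λ hΛ hspec hΛle m s t ht hts hs v
  have hk : Nonempty (Fin (H.mesh k).N) := HpDG.Mesh.nonempty_elements hΩ.nonempty
  have hK : Nonempty (Fin (H.mesh (Fin.last n)).N) := HpDG.Mesh.nonempty_elements hΩ.nonempty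
  have hhk : 0 < (H.mesh k).size := HpDG.Mesh.size_pos (Classical.arbitrary _)
  have hhK : 0 < (H.mesh (Fin.last n)).size := HpDG.Mesh.size_pos (Classical.arbitrary _)
  have hsymm : ∀ u w, (H.mesh k).ip b (H.A M α k b u) w = (H.mesh k).ip b (H.A M α k b w) u :=
    fun u w => by
      rw [H.ip_A, H.ip_A]
      exact HpDG.Mesh.form_symm _ α M _ _
  have hpos : ∀ u, 0 ≤ (H.mesh k).ip b (H.A M α k b u) u := fun u => by
    rw [H.ip_A]
    exact HpDG.Mesh.form_nonneg _ hα.le M hM _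
  have hconst := HpDG.sqrt_rpow_mul_rpow_le (P := (H.deg (Fin.last n) : ℝ) * H.deg k)
    (Q := (H.mesh (Fin.last n)).size * (H.mesh k).size) (a := s - t) (M := 1 + (m : ℝ)) hC₀.le hΛ.le
    (by positivity) (by positivity) (by positivity) (by linarith) (by linarith)
    (by rwa [mul_pow])
  rw [neg_sub] at hconst
  refine (HpDG.Mesh.powNorm_one_sub_pow_le b hsymm hpos hΛ hspec ht hts hs m v).trans ?_
  exact mul_le_mul_of_nonneg_right hconst (Real.sqrt_nonneg _)
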